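/- There are absolute constants $\tilde c,\hat c,C,c>0$ such that the following holds. For a vector $x\in\mathbb C^n$ and $1\le m\le n$, let $x^*_m$ denote the $m$-th largest of the numbers $|x_1|,\dots,|x_n|$, counted with multiplicity. Let $\eta\in(0,1)$ and $\rho>0$, let $k<n$ with $\eta n\ge 1$, and let $V$ be a $k\times n$ complex matrix with orthonormal rows $\mathrm{row}_1(V),\dots,\mathrm{row}_k(V)$ and columns $V_1,\dots,V_n$. Assume that $$\big(\mathrm{row}_i(V)\big)^*_{\lfloor\eta n\rfloor}\ \ge\ \frac{\rho}{\sqrt n}\qquad\text{for all } i\in\{1,\dots,k\},$$ and put $\ell:=\lfloor\tilde c\,\eta^3\rho^2k\rfloor$. Then $\ell\le n$ and the following two statements hold. (A) Let $\beta_1,\dots,\beta_n$ be independent Bernoulli($\ell/n$) random variables with values in $\{0,1\}$, and let $J:=\{j:\beta_j=1\}$. Then with probability at least $(\hat c\,\eta)^\ell$ the set $J$ simultaneously satisfies 1. $|J|=\ell$; 2. $\|V_j\|_2\le\sqrt{\dfrac{Ck}{\eta n}}$ for all $j\in J$; 3. $\Big\|\sum_{j\in J}z_jV_j\Big\|_2\ge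 c\,\rho\,\sqrt{\eta\,\dfrac kn}\;\|z\|_2$ for all $z\in\mathbb C^J$. (B) Let $I$ be a random set uniformly distributed among the subsets of $\{1,\dots,n\}$ of cardinality $\ell$. Then with probability at least $(\hat c\,\eta)^\ell$ the set $I$ simultaneously satisfies 2 and 3 (with $I$ in place of $J$), with the same constants. -/

import Mathlib

open MeasureTheory ProbabilityTheory

/-- The non-increasing rearrangement of the vector of absolute values `(|x_1|, …, |x_n|)`. -/
noncomputable def decRearrangement {n : ℕ} (x : Fin n → ℂ) : Fin n → ℝ :=
  fun i => ‖x (Tuple.sort (fun j => -‖x j‖) i)‖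

theorem decRearrangement_antitone {n : ℕ} (x : Fin n → ℂ) : Antitone (decRearrangement x) := by
  intro i j hij
  have h := Tuple.monotone_sort (fun j => -‖x j‖) hij
  simpa [decRearrangement] using h

/-- The `m`-th largest absolute value of a coordinate of `x`, counted from `m = 1`;
the value outside `1 ≤ m ≤ n` is a placeholder. -/
noncomputable def orderStat {n : ℕ} (x : Fin n → ℂ) (m : ℕ) : ℝ :=
  if h : 1 ≤ m ∧ m ≤ n then decRearrangement x ⟨m - 1, by omega⟩ else 0

/-- The `i`-th row of `V` as a vector of the Hilbert space `ℂⁿ`. -/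
noncomputable def rowVec {k n : ℕ} (V : Matrix (Fin k) (Fin n) ℂ) (i : Fin k) :
    EuclideanSpace ℂ (Fin n) :=
  WithLp.toLp 2 (fun j => V i j)

/-- The `j`-th column of `V` as a vector of the Hilbert space `ℂᵏ`. -/
noncomputable def colVec {k n : ℕ} (V : Matrix (Fin k) (Fin n) ℂ) (j : Fin n) :
    EuclideanSpace ℂ (Fin k) :=
  WithLp.toLp 2 (fun i => V i j)

/-- The columns of `V` indexed by `J` have Euclidean norm at most `√(C k / (η n))`. -/
def ColumnsBounded {k n : ℕ} (V : Matrix (Fin k) (Fin n) ℂ) (C η : ℝ) (J : Finset (Fin n)) :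
    Prop :=
  ∀ j ∈ J, ‖colVec V j‖ ≤ √(C * k / (η * n))

/-- The columns of `V` indexed by `J` satisfy
`‖∑ z_j V_j‖ ≥ c ρ √(η k / n) ‖z‖` for every `z ∈ ℂᴶ`. -/
def ColumnsInvertible {k n : ℕ} (V : Matrix (Fin k) (Fin n) ℂ) (c η ρ : ℝ)
    (J : Finset (Fin n)) : Prop :=
  ∀ z : EuclideanSpace ℂ J, c * ρ * √(η * (k / n)) * ‖z‖ ≤ ‖∑ j : J, z j • colVec V j‖

/-- `b` is a Bernoulli (`0/1`) random variable taking the value `1` with probability `p`. -/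
def IsBernoulli {Ω : Type*} [MeasurableSpace Ω] (P : Measure Ω) (b : Ω → ℝ) (p : ℝ) : Prop :=
  Measurable b ∧ P {ω | b ω = 1} = ENNReal.ofReal p ∧ P {ω | b ω = 0} = ENNReal.ofReal (1 - p)

/-- The random set `{j ∈ [n] : β_j = 1}`. -/
noncomputable def selectedSet {Ω : Type*} {n : ℕ} (β : Fin n → Ω → ℝ) (ω : Ω) : Finset (Fin n) :=
  open Classical in Finset.univ.filter (fun j => β j ω = 1)

/-- `I` is a random set, uniformly distributed among the subsets of `[n]` of cardinality `l`. -/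
def IsUniformSubset {Ω : Type*} [MeasurableSpace Ω] {n : ℕ} (P : Measure Ω)
    (I : Ω → Finset (Fin n)) (l : ℕ) : Prop :=
  (∀ S, MeasurableSet {ω | I ω = S}) ∧
    ∀ S, P {ω | I ω = S} = if S.card = l then ((n.choose l : ENNReal))⁻¹ else 0

/-! The proof is restricted invertibility by a barrier argument, arranged so that it counts good
sets instead of producing one. Orthonormality of the rows makes the columns a Parseval frame of
`ℂᵏ`. Double counting large entries and Markov's inequality leave at least `η n / 8` columns whose
norms are bounded above and below (`exists_balanced_columns`); normalized, they form a set `G` of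
unit vectors with Bessel constant `B` of order `n / (ρ² η k)`.

Unit vectors are then chosen one at a time. The Gram matrix `H` of the current choice stays above a
barrier `b`, and `tr (H - b)⁻¹` is at most `8` times the number of vectors. By averaging over `G`,
at least half of its members extend any admissible tuple (`BarrierBound.exists_half_extensions`).
Hence there are at least `(|G| / 2) ^ l` ordered `l`-tuples, each without repetition, and at least
`(|G| / 2) ^ l / l!` sets. Multiplying by the probability of a single set gives both (A) and (B). -/

/-! ### Barrier potential for Gram matrices and its one-vector update. -/

section Barrier

open Matrix
open scoped ComplexOrder InnerProductSpace

variable {ι κ E : Type*} [Fintype ι] [DecidableEq ι]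

/-- Positivity and trace of the inverse of a positive definite matrix bordered by one vector. -/
theorem posDef_and_trace_inv_fromBlocks {A : Matrix ι ι ℂ} (hA : A.PosDef)
    (w : Matrix ι (Fin 1) ℂ) (d q : ℝ) (hq : 0 < q)
    (hS : (d : ℂ) • (1 : Matrix (Fin 1) (Fin 1) ℂ) - wᴴ * A⁻¹ * w = (q : ℂ) • 1) :
    (fromBlocks A w wᴴ ((d : ℂ) • 1)).PosDef ∧
      (trace (fromBlocks A w wᴴ ((d : ℂ) • 1))⁻¹).re =
        (trace A⁻¹).re + (1 + (trace (wᴴ * (A⁻¹ * A⁻¹) * w)).re) / q := by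
  have hq0 : (q : ℂ) ≠ 0 := by exact_mod_cast hq.ne'
  let iA : Invertible A := hA.isUnit.invertible
  have hSi : ((q : ℂ) • (1 : Matrix (Fin 1) (Fin 1) ℂ)) * ((q : ℂ)⁻¹ • 1) = 1 := by
    rw [Matrix.smul_mul, Matrix.one_mul, smul_smul, mul_inv_cancel₀ hq0, one_smul]
  let iS : Invertible ((d : ℂ) • (1 : Matrix (Fin 1) (Fin 1) ℂ) - wᴴ * ⅟A * w) := by
    rw [invOf_eq_nonsing_inv, hS]
    exact invertibleOfRightInverse _ _ hSi
  have hSinv : ⅟((d : ℂ) • (1 : Matrix (Fin 1) (Fin 1) ℂ) - wᴴ * ⅟A * w) = (q : ℂ)⁻¹ • 1 := by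
    apply invOf_eq_right_inv
    rw [invOf_eq_nonsing_inv, hS]
    exact hSi
  let iB : Invertible (fromBlocks A w wᴴ ((d : ℂ) • 1)) := fromBlocks₁₁Invertible _ _ _ _
  constructor
  -- The Schur complement criterion yields semidefiniteness; invertibility of the block matrix makes
  -- it strict.
  · have hps : (fromBlocks A w wᴴ ((d : ℂ) • 1)).PosSemidef := by
      rw [PosDef.fromBlocks₁₁ _ _ hA, hS]
      exact PosSemidef.one.smul (by exact_mod_cast hq.le)
    rw [hps.posDef_iff_det_ne_zero]
    exact ((isUnit_iff_isUnit_det _).1 (isUnit_of_invertible _)).ne_zero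
  · have htr : ∀ (X : Matrix ι ι ℂ) (Y Z) (W : Matrix (Fin 1) (Fin 1) ℂ),
        trace (fromBlocks X Y Z W) = trace X + trace W := by
      intro X Y Z W
      simp [trace, Fintype.sum_sum_type]
    rw [← invOf_eq_nonsing_inv, invOf_fromBlocks₁₁_eq, htr, hSinv, trace_add,
      invOf_eq_nonsing_inv]
    have h1 : trace (A⁻¹ * w * ((q : ℂ)⁻¹ • (1 : Matrix (Fin 1) (Fin 1) ℂ)) * wᴴ * A⁻¹) =
        (q : ℂ)⁻¹ * trace (wᴴ * (A⁻¹ * A⁻¹) * w) := by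
      rw [Matrix.mul_smul, Matrix.mul_one, Matrix.smul_mul, Matrix.smul_mul, trace_smul,
        smul_eq_mul, Matrix.mul_assoc, trace_mul_comm]
      simp only [Matrix.mul_assoc]
    rw [h1]
    have h2 : (q : ℂ)⁻¹ = ((q⁻¹ : ℝ) : ℂ) := by push_cast; rfl
    rw [h2]
    simp only [Complex.add_re, Complex.re_ofReal_mul, trace_smul, trace_one, smul_eq_mul,
      Fintype.card_fin, Nat.cast_one, Complex.ofReal_re, mul_one]
    field_simp
    ring

variable [NormedAddCommGroup E] [InnerProductSpace ℂ E]

/-- The column of inner products of `x` with the vectors of a family. -/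
noncomputable def innerColumn (u : ι → E) (x : E) : Matrix ι (Fin 1) ℂ :=
  of fun i _ => ⟪u i, x⟫_ℂ

-- Factoring `Q = Cᴴ * C` turns each quadratic form into a sum of `‖⟪y i, x j⟫‖ ^ 2`, where the `y
-- i` are fixed combinations of `u`; the Bessel bound applies to each `y i`, and `∑ ‖y i‖ ^ 2` is
-- the trace on the right.
omit [DecidableEq ι] in
theorem sum_trace_innerColumn_le (u : ι → E) (G : Finset κ) (x : κ → E) {B : ℝ}
    (hB : ∀ y : E, ∑ j ∈ G, ‖⟪y, x j⟫_ℂ‖ ^ 2 ≤ B * ‖y‖ ^ 2)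
    {Q : Matrix ι ι ℂ} (hQ : Q.PosSemidef) :
    ∑ j ∈ G, (trace ((innerColumn u (x j))ᴴ * Q * innerColumn u (x j))).re ≤
      B * (trace (Q * gram ℂ u)).re := by
  classical
  obtain ⟨C, rfl⟩ : ∃ C : Matrix ι ι ℂ, Q = Cᴴ * C := by
    open scoped MatrixOrder in
    exact CStarAlgebra.nonneg_iff_eq_star_mul_self.1 hQ.nonneg
  set y : ι → E := fun i => ∑ l, star (C i l) • u l with hy
  have h1 : ∀ j, (trace ((innerColumn u (x j))ᴴ * (Cᴴ * C) * innerColumn u (x j))).re =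
      ∑ i, ‖⟪y i, x j⟫_ℂ‖ ^ 2 := by
    intro j
    have e : (innerColumn u (x j))ᴴ * (Cᴴ * C) * innerColumn u (x j) =
        (C * innerColumn u (x j))ᴴ * (C * innerColumn u (x j)) := by
      simp only [conjTranspose_mul, Matrix.mul_assoc]
    rw [e, trace_fin_one, mul_apply, Complex.re_sum]
    refine Finset.sum_congr rfl fun i _ => ?_
    have e2 : (C * innerColumn u (x j)) i 0 = ⟪y i, x j⟫_ℂ := by
      simp [hy, mul_apply, innerColumn, mul_comm]
    rw [conjTranspose_apply, e2, RCLike.star_def, Complex.conj_mul']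
    norm_cast
  have h2 : (trace (Cᴴ * C * gram ℂ u)).re = ∑ i, ‖y i‖ ^ 2 := by
    rw [Matrix.mul_assoc, trace_mul_comm, trace, Complex.re_sum]
    refine Finset.sum_congr rfl fun i _ => ?_
    rw [← inner_self_eq_norm_sq (𝕜 := ℂ), hy, ← star_dotProduct_gram_mulVec, diag_apply,
      mul_apply, dotProduct_mulVec]
    simp [dotProduct, vecMul, mul_apply]
  simp_rw [h1]
  rw [Finset.sum_comm, h2, Finset.mul_sum]
  exact Finset.sum_le_sum fun i _ => hB _


/-- Two uses of the resolvent identity give `tr A⁻¹ = tr S + δ tr S² + δ² tr (S A⁻¹ S)` with `S = (A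
+ δ)⁻¹`, and the last trace is nonnegative. The gain `δ tr S²` pays for the next vector. -/
theorem trace_inv_add_smul_le {A : Matrix ι ι ℂ} (hA : A.PosDef) {δ : ℝ} (hδ : 0 ≤ δ) :
    (trace (A + (δ : ℂ) • 1)⁻¹).re +
      δ * (trace ((A + (δ : ℂ) • 1)⁻¹ * (A + (δ : ℂ) • 1)⁻¹)).re ≤ (trace A⁻¹).re := by
  have hδ' : (0 : ℂ) ≤ (δ : ℂ) := by exact_mod_cast hδ
  have hA' : (A + (δ : ℂ) • 1).PosDef := hA.add_posSemidef (PosSemidef.one.smul hδ')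
  set S := (A + (δ : ℂ) • 1)⁻¹ with hS
  have hdet := (isUnit_iff_isUnit_det _).1 hA.isUnit
  have hdet' := (isUnit_iff_isUnit_det _).1 hA'.isUnit
  have e1 : A⁻¹ = S + (δ : ℂ) • (S * A⁻¹) := by
    have h : S * (A + (δ : ℂ) • 1) * A⁻¹ = A⁻¹ := by rw [nonsing_inv_mul _ hdet', Matrix.one_mul]
    rw [Matrix.mul_add, Matrix.add_mul, Matrix.mul_assoc, mul_nonsing_inv _ hdet] at h
    simpa using h.symm
  have e2 : A⁻¹ = S + (δ : ℂ) • (A⁻¹ * S) := by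
    have h : A⁻¹ * ((A + (δ : ℂ) • 1) * S) = A⁻¹ := by
      rw [mul_nonsing_inv _ hdet', Matrix.mul_one]
    rw [Matrix.add_mul, Matrix.mul_add, ← Matrix.mul_assoc, nonsing_inv_mul _ hdet] at h
    simpa using h.symm
  have e3 : trace A⁻¹ =
      trace S + (δ : ℂ) * (trace (S * S) + (δ : ℂ) * trace (S * A⁻¹ * S)) := by
    conv_lhs => rw [e1, e2]
    simp only [trace_add, trace_smul, Matrix.mul_add, Matrix.mul_smul, smul_eq_mul,
      Matrix.mul_assoc]
  have hpos : 0 ≤ (trace (S * A⁻¹ * S)).re := by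
    have h := (hA.inv.posSemidef.conjTranspose_mul_mul_same S).trace_nonneg
    rw [hA'.inv.isHermitian.eq] at h
    exact (Complex.le_def.1 h).1
  rw [e3]
  simp only [Complex.add_re, Complex.re_ofReal_mul]
  nlinarith [mul_nonneg hδ (mul_nonneg hδ hpos)]

/-- The eigenvalues of the Gram matrix of `u` exceed the barrier `b`, and the barrier potential
is at most `ψ`. -/
def BarrierBound (u : ι → E) (b ψ : ℝ) : Prop :=
  (gram ℂ u - (b : ℂ) • 1).PosDef ∧ (trace (gram ℂ u - (b : ℂ) • 1)⁻¹).re ≤ ψ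

theorem BarrierBound.comp_equiv {ι' : Type*} [Fintype ι'] [DecidableEq ι'] {u : ι → E} {b ψ : ℝ}
    (h : BarrierBound u b ψ) (e : ι' ≃ ι) : BarrierBound (u ∘ e) b ψ := by
  have hg : gram ℂ (u ∘ e) - (b : ℂ) • 1 = (gram ℂ u - (b : ℂ) • 1).submatrix e e := by
    ext i j
    simp [one_apply]
  unfold BarrierBound
  rw [hg, inv_submatrix_equiv]
  refine ⟨h.1.submatrix e.injective, ?_⟩
  have : trace ((gram ℂ u - (b : ℂ) • 1)⁻¹.submatrix e e) =
      trace (gram ℂ u - (b : ℂ) • 1)⁻¹ := by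
    simp only [trace, diag_apply, submatrix_apply]
    exact e.sum_comp fun i => (gram ℂ u - (b : ℂ) • 1)⁻¹ i i
  rw [this]
  exact h.2

theorem BarrierBound.norm_sum_sq {u : ι → E} {b ψ : ℝ} (h : BarrierBound u b ψ) (z : ι → ℂ) :
    b * ∑ i, ‖z i‖ ^ 2 ≤ ‖∑ i, z i • u i‖ ^ 2 := by
  have h1 := (Complex.le_def.1 (h.1.posSemidef.dotProduct_mulVec_nonneg z)).1
  rw [sub_mulVec, dotProduct_sub, star_dotProduct_gram_mulVec, smul_mulVec, one_mulVec,
    dotProduct_smul, Complex.sub_re, smul_eq_mul, Complex.re_ofReal_mul] at h1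
  have h2 : (star z ⬝ᵥ z).re = ∑ i, ‖z i‖ ^ 2 := by
    rw [dotProduct, Complex.re_sum]
    refine Finset.sum_congr rfl fun i _ => ?_
    rw [Pi.star_apply, RCLike.star_def, Complex.conj_mul']
    norm_cast
  rw [h2] at h1
  have h3 := inner_self_eq_norm_sq (𝕜 := ℂ) (∑ i, z i • u i)
  simp only [RCLike.re_to_complex, Complex.zero_re] at h1 h3
  linarith

theorem card_filter_lt_le (G : Finset κ) (f : κ → ℝ) {t : ℝ} (ht : 0 < t)
    (hf : ∀ j ∈ G, 0 ≤ f j) (hsum : ∑ j ∈ G, f j ≤ t * (G.card / 4)) :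
    ((G.filter fun j => t < f j).card : ℝ) ≤ G.card / 4 := by
  have h : ((G.filter fun j => t < f j).card : ℝ) * t ≤ ∑ j ∈ G, f j := by
    rw [← nsmul_eq_mul]
    refine (Finset.card_nsmul_le_sum _ f t fun j hj => ?_).trans
      (Finset.sum_le_sum_of_subset_of_nonneg (Finset.filter_subset _ G) fun j hj _ => hf j hj)
    exact (Finset.mem_filter.1 hj).2.le
  nlinarith

/-- At least half of the vectors of a family with small Bessel constant can be appended while the
barrier is lowered by `δ` and the potential budget is raised by `8`. -/
theorem BarrierBound.exists_half_extensions {u : ι → E} {b δ : ℝ}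
    (h : BarrierBound u b (8 * Fintype.card ι)) (hδ : 0 < δ) (hδb : δ ≤ b) (hb : b ≤ 1 / 2)
    (G : Finset κ) (x : κ → E) (hx : ∀ j ∈ G, ‖x j‖ = 1) {B : ℝ} (hB0 : 0 ≤ B)
    (hB : ∀ y : E, ∑ j ∈ G, ‖⟪y, x j⟫_ℂ‖ ^ 2 ≤ B * ‖y‖ ^ 2)
    (hBδ : B ≤ G.card * δ / 64) (hBs : B * Fintype.card ι ≤ G.card / 256) :
    ∃ G' ⊆ G, (G.card : ℝ) / 2 ≤ G'.card ∧ ∀ j ∈ G',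
      BarrierBound (Sum.elim u fun _ : Fin 1 => x j) (b - δ) (8 * (Fintype.card ι + 1)) := by
  classical
  obtain ⟨hpd, htr⟩ := h
  have hδ' : (0 : ℂ) ≤ (δ : ℂ) := by exact_mod_cast hδ.le
  set H := gram ℂ u with hH
  set A' := H - ((b - δ : ℝ) : ℂ) • (1 : Matrix ι ι ℂ) with hA'
  have hAA : A' = (H - (b : ℂ) • 1) + (δ : ℂ) • 1 := by
    rw [hA', Complex.ofReal_sub, sub_smul]; abel
  have hpd' : A'.PosDef := by
    rw [hAA]; exact hpd.add_posSemidef (PosSemidef.one.smul hδ')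
  have hdet := (isUnit_iff_isUnit_det _).1 hpd'.isUnit
  set R := A'⁻¹ with hR
  have hRps : R.PosSemidef := hpd'.inv.posSemidef
  have hRH : R * H = 1 + ((b - δ : ℝ) : ℂ) • R := by
    have h1 : H = A' + ((b - δ : ℝ) : ℂ) • 1 := by rw [hA']; abel
    rw [h1, Matrix.mul_add, nonsing_inv_mul _ hdet, Matrix.mul_smul, Matrix.mul_one]
  have hRRps : (R * R).PosSemidef := by
    have := posSemidef_conjTranspose_mul_self R
    rwa [hpd'.inv.isHermitian.eq] at this
  set s : ℝ := (Fintype.card ι : ℝ) with hs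
  set N : ℝ := (G.card : ℝ) with hN
  have hs0 : 0 ≤ s := Nat.cast_nonneg _
  have hN0 : 0 ≤ N := Nat.cast_nonneg _
  set τ := (trace R).re with hτ
  set θ := (trace (R * R)).re with hθ
  have hτ0 : 0 ≤ τ := (Complex.le_def.1 hRps.trace_nonneg).1
  have hθ0 : 0 ≤ θ := (Complex.le_def.1 hRRps.trace_nonneg).1
  have hdec : τ + δ * θ ≤ 8 * s := by
    have := trace_inv_add_smul_le hpd hδ.le
    rw [← hAA] at this
    exact this.trans htr
  set w : κ → Matrix ι (Fin 1) ℂ := fun j => innerColumn u (x j) with hw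
  set f : κ → ℝ := fun j => (trace ((w j)ᴴ * R * w j)).re with hf
  set g : κ → ℝ := fun j => (trace ((w j)ᴴ * (R * R) * w j)).re with hg
  have hf0 : ∀ j, 0 ≤ f j := fun j =>
    (Complex.le_def.1 (hRps.conjTranspose_mul_mul_same (w j)).trace_nonneg).1
  have hg0 : ∀ j, 0 ≤ g j := fun j =>
    (Complex.le_def.1 (hRRps.conjTranspose_mul_mul_same (w j)).trace_nonneg).1
  have hδθ : 0 ≤ δ * θ := mul_nonneg hδ.le hθ0
  -- Since `b - δ ≤ 1 / 2` and `τ ≤ 8 s`, the trace of `R * H` is at most `5 s`.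
  have hfs : ∑ j ∈ G, f j ≤ 1 / 8 * (N / 4) := by
    refine (sum_trace_innerColumn_le u G x hB hRps).trans ?_
    rw [hRH, trace_add, trace_smul, trace_one, smul_eq_mul, Complex.add_re,
      Complex.re_ofReal_mul, Complex.natCast_re]
    have : s + (b - δ) * τ ≤ 5 * s := by nlinarith
    calc B * (s + (b - δ) * τ) ≤ B * (5 * s) := by gcongr
      _ ≤ _ := by linarith
  have hgs : ∑ j ∈ G, g j ≤ (1 / 8 + δ * θ / 32) * (N / 4) := by
    refine (sum_trace_innerColumn_le u G x hB hRRps).trans ?_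
    rw [Matrix.mul_assoc, hRH, Matrix.mul_add, Matrix.mul_one, Matrix.mul_smul, trace_add,
      trace_smul, smul_eq_mul, Complex.add_re, Complex.re_ofReal_mul]
    have h1 : τ + (b - δ) * θ ≤ 8 * s + 1 / 2 * θ := by nlinarith
    calc B * (τ + (b - δ) * θ) ≤ B * (8 * s + 1 / 2 * θ) := by gcongr
      _ = 8 * (B * s) + 1 / 2 * (B * θ) := by ring
      _ ≤ 8 * (N / 256) + 1 / 2 * (N * δ / 64 * θ) := by gcongr
      _ = _ := by ring
  have hbadf := card_filter_lt_le G f (by norm_num) (fun j _ => hf0 j) hfs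
  have hbadg := card_filter_lt_le G g (by positivity) (fun j _ => hg0 j) hgs
  have hgood : ∀ j ∈ G, f j ≤ 1 / 8 → g j ≤ 1 / 8 + δ * θ / 32 →
      BarrierBound (Sum.elim u fun _ : Fin 1 => x j) (b - δ) (8 * (s + 1)) := by
    intro j hj hfj hgj
    have hblock : gram ℂ (Sum.elim u fun _ : Fin 1 => x j) - ((b - δ : ℝ) : ℂ) • 1 =
        fromBlocks A' (w j) (w j)ᴴ (((1 - (b - δ) : ℝ) : ℂ) • 1) := by
      ext (i | i) (i' | i')
      · simp [hA', hH, one_apply]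
      · simp [hw, innerColumn]
      · simp [hw, innerColumn]
      · have : i = i' := Subsingleton.elim _ _
        subst this
        simp [inner_self_eq_norm_sq_to_K, hx j hj]
    set q : ℝ := 1 - (b - δ) - f j with hq
    have hq0 : 3 / 8 ≤ q := by linarith
    have hS : ((1 - (b - δ) : ℝ) : ℂ) • (1 : Matrix (Fin 1) (Fin 1) ℂ) - (w j)ᴴ * A'⁻¹ * w j =
        (q : ℂ) • 1 := by
      have him := (Complex.le_def.1 (hRps.conjTranspose_mul_mul_same (w j)).trace_nonneg).2
      have htr1 : trace ((w j)ᴴ * R * w j) = (f j : ℂ) := Complex.ext rfl him.symm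
      rw [trace_fin_one] at htr1
      ext i i'
      have hi : i = 0 := Subsingleton.elim _ _
      have hi' : i' = 0 := Subsingleton.elim _ _
      subst hi hi'
      rw [Matrix.sub_apply, htr1]
      simp [hq]
    obtain ⟨p1, p2⟩ := posDef_and_trace_inv_fromBlocks hpd' (w j) _ q (by linarith) hS
    refine ⟨by rw [hblock]; exact p1, ?_⟩
    rw [hblock, p2]
    -- The quotient is at most `3 + δ θ / 12`. Its `δ θ` part is absorbed by the drop in `hdec`, so
    -- the potential grows by at most `8`.
    have h3 : (1 + g j) / q ≤ 8 + δ * θ := by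
      rw [div_le_iff₀ (by linarith)]
      nlinarith
    have : τ + (1 + g j) / q ≤ 8 * (s + 1) := by linarith
    exact this
  refine ⟨G.filter fun j => BarrierBound (Sum.elim u fun _ : Fin 1 => x j) (b - δ)
    (8 * (s + 1)), Finset.filter_subset _ _, ?_, fun j hj => (Finset.mem_filter.1 hj).2⟩
  have hcover : G ⊆ (G.filter fun j => BarrierBound (Sum.elim u fun _ : Fin 1 => x j) (b - δ)
      (8 * (s + 1))) ∪ ((G.filter fun j => 1 / 8 < f j) ∪
        (G.filter fun j => 1 / 8 + δ * θ / 32 < g j)) := by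
    intro j hj
    simp only [Finset.mem_union, Finset.mem_filter, hj, true_and]
    by_contra! hcon
    exact hcon.1 (hgood j hj hcon.2.1 hcon.2.2)
  have hcard : N ≤ _ := Nat.cast_le (α := ℝ).2 ((Finset.card_le_card hcover).trans
    ((Finset.card_union_le _ _).trans (Nat.add_le_add_left (Finset.card_union_le _ _) _)))
  push_cast at hcard
  linarith

end Barrier

/-! ### Counting tuples, then sets, of well-invertible unit vectors. -/

section Selection

open scoped ComplexOrder InnerProductSpace

variable {κ E : Type*} [NormedAddCommGroup E] [InnerProductSpace ℂ E]

/-- Many ordered tuples of unit vectors satisfy the barrier bound. -/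
theorem exists_many_barrier_tuples (G : Finset κ) (x : κ → E) (hx : ∀ j ∈ G, ‖x j‖ = 1) {B : ℝ}
    (hB0 : 0 ≤ B) (hB : ∀ y : E, ∑ j ∈ G, ‖⟪y, x j⟫_ℂ‖ ^ 2 ≤ B * ‖y‖ ^ 2)
    {l : ℕ} (hl : B * l ≤ G.card / 256) (s : ℕ) (hs : s ≤ l) :
    ∃ T : Finset (Fin s → κ), ((G.card : ℝ) / 2) ^ s ≤ T.card ∧
      ∀ t ∈ T, (∀ i, t i ∈ G) ∧ BarrierBound (x ∘ t) (1 / 2 - s * (1 / (4 * l))) (8 * s) := by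
  classical
  induction s with
  | zero =>
    refine ⟨{default}, by simp, fun t _ => ⟨fun i => i.elim0, ?_, by simp [Matrix.trace]⟩⟩
    refine .of_dotProduct_mulVec_pos (Matrix.ext fun i => i.elim0) fun z hz => ?_
    exact absurd (Subsingleton.elim _ _) hz
  | succ s ih =>
    obtain ⟨T, hT, hgood⟩ := ih (by omega)
    have hl0 : (0 : ℝ) < l := by exact_mod_cast (show 0 < l by omega)
    have hsl : (s : ℝ) + 1 ≤ l := by exact_mod_cast hs
    -- With this step, `l` extensions lower the barrier from `1 / 2` to `1 / 4`, and the condition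
    -- `B ≤ |G| δ / 64` becomes exactly `B l ≤ |G| / 256`.
    set δ : ℝ := 1 / (4 * l) with hδ
    have hδ0 : 0 < δ := by positivity
    have hlδ : l * δ = 1 / 4 := by rw [hδ]; field_simp
    have hext : ∀ t ∈ T, ∃ G' ⊆ G, (G.card : ℝ) / 2 ≤ G'.card ∧ ∀ j ∈ G',
        BarrierBound (Sum.elim (x ∘ t) fun _ : Fin 1 => x j) (1 / 2 - s * δ - δ)
          (8 * (Fintype.card (Fin s) + 1)) := by
      intro t ht
      refine BarrierBound.exists_half_extensions ?_ hδ0 (by nlinarith) ?_ G x hx hB0 hB ?_ ?_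
      · simpa using (hgood t ht).2
      · have : 0 ≤ s * δ := by positivity
        linarith
      · rw [hδ]
        have : (G.card : ℝ) * (1 / (4 * l)) / 64 = (G.card / 256) / l := by field_simp; ring
        rw [this, le_div_iff₀ hl0]
        exact hl
      · rw [Fintype.card_fin]
        exact (mul_le_mul_of_nonneg_left (by linarith) hB0).trans hl
    choose! ext hsub hcard hbar using hext
    have hinj : Function.Injective fun p : (_ : Fin s → κ) × κ =>
        (Fin.snoc p.1 p.2 : Fin (s + 1) → κ) := by
      rintro ⟨t, j⟩ ⟨t', j'⟩ h
      obtain ⟨h1, h2⟩ := Fin.snoc_injective2 h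
      exact Sigma.ext h1 (heq_of_eq h2)
    refine ⟨(T.sigma ext).map ⟨_, hinj⟩, ?_, ?_⟩
    · rw [Finset.card_map, Finset.card_sigma, pow_succ]
      push_cast
      calc ((G.card : ℝ) / 2) ^ s * (G.card / 2) ≤ T.card * (G.card / 2) := by gcongr
        _ = ∑ t ∈ T, (G.card : ℝ) / 2 := by rw [Finset.sum_const, nsmul_eq_mul]
        _ ≤ _ := Finset.sum_le_sum fun t ht => hcard t ht
    · intro t' ht'
      obtain ⟨⟨t, j⟩, hp, rfl⟩ := Finset.mem_map.1 ht'
      obtain ⟨ht, hj⟩ := Finset.mem_sigma.1 hp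
      constructor
      · intro i
        refine Fin.lastCases ?_ (fun i => ?_) i
        · simpa using hsub t ht hj
        · simpa using (hgood t ht).1 i
      · have h := (hbar t ht j hj).comp_equiv finSumFinEquiv.symm
        have e : (Sum.elim (x ∘ t) fun _ : Fin 1 => x j) ∘ finSumFinEquiv.symm =
            x ∘ (Fin.snoc t j : Fin (s + 1) → κ) := by
          funext i
          refine Fin.lastCases ?_ (fun i => ?_) i
          · have : finSumFinEquiv.symm (Fin.last s) = Sum.inr (0 : Fin 1) := by
              rw [Equiv.symm_apply_eq]; rfl
            simp [this]
          · have : finSumFinEquiv.symm (Fin.castSucc i) = Sum.inl (β := Fin 1) i := by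
              rw [Equiv.symm_apply_eq]; rfl
            simp [this]
        rw [e] at h
        convert h using 1
        · rfl
        · push_cast; ring
        · rw [Fintype.card_fin]; push_cast; rfl

/-- Injective tuples with the same image `S` embed into the `l!` injections `Fin l ↪ S`. -/
theorem card_le_factorial_mul_card_image {l : ℕ} [DecidableEq κ] (T : Finset (Fin l → κ))
    (hT : ∀ t ∈ T, Function.Injective t) :
    T.card ≤ l.factorial * (T.image fun t => Finset.univ.image t).card := by
  refine Finset.card_le_mul_card_image T _ fun S hS => ?_
  obtain ⟨t₀, ht₀, rfl⟩ := Finset.mem_image.1 hS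
  set S := Finset.univ.image t₀
  have hScard : S.card = l := by
    rw [Finset.card_image_of_injective _ (hT t₀ ht₀), Finset.card_univ, Fintype.card_fin]
  have hfac : Fintype.card (Fin l ↪ S) = l.factorial := by
    rw [Fintype.card_embedding_eq, Fintype.card_coe, Fintype.card_fin, hScard,
      Nat.descFactorial_self]
  rw [← hfac, ← Fintype.card_coe]
  refine Fintype.card_le_of_injective (fun t => ⟨fun i => ⟨t.1 i, ?_⟩, ?_⟩) ?_
  · exact (Finset.ext_iff.1 (Finset.mem_filter.1 t.2).2 _).1
      (Finset.mem_image_of_mem t.1 (Finset.mem_univ i))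
  · intro i i' h
    exact hT _ (Finset.mem_filter.1 t.2).1 (congrArg Subtype.val h)
  · intro t t' h
    refine Subtype.ext (funext fun i => ?_)
    exact congrArg Subtype.val (DFunLike.congr_fun h i)

/-- Restricted invertibility with a count: a family of unit vectors with small Bessel constant
has many well-invertible subfamilies of cardinality `l`. -/
theorem exists_many_invertible_subsets (G : Finset κ) (x : κ → E) (hx : ∀ j ∈ G, ‖x j‖ = 1)
    {B : ℝ} (hB0 : 0 ≤ B) (hB : ∀ y : E, ∑ j ∈ G, ‖⟪y, x j⟫_ℂ‖ ^ 2 ≤ B * ‖y‖ ^ 2)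
    {l : ℕ} (hl : B * l ≤ G.card / 256) :
    ∃ F : Finset (Finset κ), ((G.card : ℝ) / 2) ^ l ≤ l.factorial * F.card ∧
      ∀ S ∈ F, S ⊆ G ∧ S.card = l ∧
        ∀ z : κ → ℂ, 1 / 4 * ∑ j ∈ S, ‖z j‖ ^ 2 ≤ ‖∑ j ∈ S, z j • x j‖ ^ 2 := by
  classical
  obtain ⟨T, hT, hgood⟩ := exists_many_barrier_tuples G x hx hB0 hB hl l le_rfl
  -- For `l = 0` the quotient is `0` by convention and the level is `1 / 2`.
  have hlevel : (1 / 4 : ℝ) ≤ 1 / 2 - l * (1 / (4 * l)) := by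
    rcases Nat.eq_zero_or_pos l with rfl | h
    · norm_num
    · have : (0 : ℝ) < l := by exact_mod_cast h
      have : (l : ℝ) * (1 / (4 * l)) = 1 / 4 := by field_simp
      rw [this]; norm_num
  have hinj : ∀ t ∈ T, Function.Injective t := by
    intro t ht
    obtain ⟨hpd, -⟩ := (hgood t ht).2
    -- Adding back the nonnegative barrier makes the Gram matrix itself positive definite; the
    -- chosen vectors are then independent, so no index repeats.
    have h0 : (0 : ℂ) ≤ ((1 / 2 - l * (1 / (4 * l)) : ℝ) : ℂ) := by
      exact_mod_cast (by linarith : (0 : ℝ) ≤ 1 / 2 - l * (1 / (4 * l)))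
    have h1 := hpd.add_posSemidef (Matrix.PosSemidef.one.smul h0)
    rw [sub_add_cancel] at h1
    exact (Matrix.linearIndependent_of_posDef_gram h1).injective.of_comp
  refine ⟨T.image fun t => Finset.univ.image t, ?_, ?_⟩
  · exact hT.trans (by exact_mod_cast card_le_factorial_mul_card_image T hinj)
  · intro S hS
    obtain ⟨t, ht, rfl⟩ := Finset.mem_image.1 hS
    refine ⟨?_, ?_, fun z => ?_⟩
    · exact Finset.image_subset_iff.2 fun i _ => (hgood t ht).1 i
    · rw [Finset.card_image_of_injective _ (hinj t ht), Finset.card_univ, Fintype.card_fin]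
    · rw [Finset.sum_image fun i _ i' _ h => hinj t ht h,
        Finset.sum_image fun i _ i' _ h => hinj t ht h]
      refine le_trans ?_ ((hgood t ht).2.norm_sum_sq fun i => z (t i))
      gcongr

end Selection

/-! ### From the row hypothesis to many good column sets. -/

section Columns

open scoped InnerProductSpace

theorem le_card_of_le_orderStat {n m : ℕ} (hm : 1 ≤ m) (hmn : m ≤ n) {x : Fin n → ℂ} {r : ℝ}
    (h : r ≤ orderStat x m) : m ≤ (Finset.univ.filter fun j => r ≤ ‖x j‖).card := by
  rw [orderStat, dif_pos ⟨hm, hmn⟩] at h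
  have hinj : Function.Injective fun i : Fin m =>
      Tuple.sort (fun j => -‖x j‖) (Fin.castLE hmn i) :=
    (Equiv.injective _).comp (Fin.castLE_injective hmn)
  calc m = ((Finset.univ : Finset (Fin m)).map ⟨_, hinj⟩).card := by simp
    _ ≤ _ := Finset.card_le_card fun j hj => ?_
  obtain ⟨i, -, rfl⟩ := Finset.mem_map.1 hj
  refine Finset.mem_filter.2 ⟨Finset.mem_univ _, h.trans ?_⟩
  exact decRearrangement_antitone x (Fin.mk_le_mk.2 (Nat.le_sub_one_of_lt i.2))

variable {k n : ℕ} {V : Matrix (Fin k) (Fin n) ℂ}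

theorem norm_rowVec_sq (i : Fin k) : ‖rowVec V i‖ ^ 2 = ∑ j, ‖V i j‖ ^ 2 := by
  rw [EuclideanSpace.norm_sq_eq]; rfl

theorem norm_colVec_sq (j : Fin n) : ‖colVec V j‖ ^ 2 = ∑ i, ‖V i j‖ ^ 2 := by
  rw [EuclideanSpace.norm_sq_eq]; rfl

theorem sum_norm_colVec_sq (hV : Orthonormal ℂ (rowVec V)) : ∑ j, ‖colVec V j‖ ^ 2 = k := by
  simp_rw [norm_colVec_sq]
  rw [Finset.sum_comm]
  simp_rw [← norm_rowVec_sq, hV.1]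
  simp

/-- The inner products with the columns are the coordinates of a combination of the orthonormal
rows, so this is Pythagoras. -/
theorem sum_norm_inner_colVec_sq (hV : Orthonormal ℂ (rowVec V))
    (y : EuclideanSpace ℂ (Fin k)) : ∑ j, ‖⟪y, colVec V j⟫_ℂ‖ ^ 2 = ‖y‖ ^ 2 := by
  have h1 : ∀ j, ⟪y, colVec V j⟫_ℂ = (∑ i, star (y i) • rowVec V i) j := by
    intro j
    simp [PiLp.inner_apply, colVec, rowVec, mul_comm]
  simp_rw [h1]
  rw [← EuclideanSpace.norm_sq_eq, ← inner_self_eq_norm_sq (𝕜 := ℂ), hV.inner_sum,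
    EuclideanSpace.norm_sq_eq]
  simp only [RCLike.re_to_complex, Complex.re_sum]
  refine Finset.sum_congr rfl fun i _ => ?_
  rw [Complex.conj_mul', RCLike.star_def, RCLike.norm_conj]
  norm_cast

/-- A unit row has at least `⌊η n⌋ ≥ η n / 2` entries of modulus at least `ρ / √n`. This is what
keeps `l` below `k`. -/
theorem eta_mul_rho_sq_le_two (hV : Orthonormal ℂ (rowVec V)) {η ρ : ℝ} (hη : 0 < η)
    (hη1 : η < 1) (hρ : 0 < ρ) (hn : 1 ≤ ⌊η * n⌋₊) (i : Fin k)
    (hrow : ρ / √(n : ℝ) ≤ orderStat (V i) ⌊η * n⌋₊) : η * ρ ^ 2 ≤ 2 := by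
  set m := ⌊η * n⌋₊ with hm
  have hmle : (m : ℝ) ≤ η * n := Nat.floor_le (by positivity)
  have hn0 : (0 : ℝ) < n := by
    rcases Nat.eq_zero_or_pos n with rfl | h
    · simp at hm; omega
    · exact_mod_cast h
  have hmn : m ≤ n := by
    have : (m : ℝ) ≤ n := by nlinarith
    exact_mod_cast this
  have hmlt : η * n < m + 1 := Nat.lt_floor_add_one _
  have hm1 : (1 : ℝ) ≤ m := by exact_mod_cast hn
  have hc := le_card_of_le_orderStat hn hmn hrow
  have hc' : (m : ℝ) ≤ ((Finset.univ.filter fun j => ρ / √(n : ℝ) ≤ ‖V i j‖).card : ℝ) := by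
    exact_mod_cast hc
  have h1 : ((Finset.univ.filter fun j => ρ / √(n : ℝ) ≤ ‖V i j‖).card : ℝ) * (ρ ^ 2 / n) ≤ 1 := by
    have h2 := hV.1 i
    have h3 := norm_rowVec_sq (V := V) i
    rw [h2, one_pow] at h3
    rw [h3, ← nsmul_eq_mul]
    refine (Finset.card_nsmul_le_sum _ (fun j => ‖V i j‖ ^ 2) _ fun j hj => ?_).trans
      (Finset.sum_le_sum_of_subset_of_nonneg (Finset.filter_subset _ _)
        fun j _ _ => by positivity)
    have := (Finset.mem_filter.1 hj).2
    calc ρ ^ 2 / n = (ρ / √(n : ℝ)) ^ 2 := by rw [div_pow, Real.sq_sqrt hn0.le]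
      _ ≤ _ := by gcongr
  have h4 : (η * n / 2) * (ρ ^ 2 / n) ≤ 1 :=
    (mul_le_mul_of_nonneg_right (by linarith) (by positivity)).trans h1
  have h5 : (η * n / 2) * (ρ ^ 2 / n) = η * ρ ^ 2 / 2 := by field_simp
  linarith

/-- A proportion of the columns have Euclidean norm of controlled size. -/
theorem exists_balanced_columns (hV : Orthonormal ℂ (rowVec V)) {η ρ : ℝ} (hη : 0 < η)
    (hη1 : η < 1) (hρ : 0 < ρ) (hk : 0 < k) (hn : 1 ≤ ⌊η * n⌋₊)
    (hrow : ∀ i : Fin k, ρ / √(n : ℝ) ≤ orderStat (V i) ⌊η * n⌋₊) :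
    ∃ G : Finset (Fin n), η * n / 8 ≤ G.card ∧ ∀ j ∈ G,
      ρ ^ 2 * η * k / (4 * n) ≤ ‖colVec V j‖ ^ 2 ∧ ‖colVec V j‖ ^ 2 ≤ 8 * k / (η * n) := by
  classical
  set m := ⌊η * n⌋₊ with hm
  have hmle : (m : ℝ) ≤ η * n := Nat.floor_le (by positivity)
  have hn0 : (0 : ℝ) < n := by
    rcases Nat.eq_zero_or_pos n with rfl | h
    · simp at hm; omega
    · exact_mod_cast h
  have hk0 : (0 : ℝ) < k := by exact_mod_cast hk
  have hmn : m ≤ n := by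
    have : (m : ℝ) ≤ n := by nlinarith
    exact_mod_cast this
  have hmlt : η * n < m + 1 := Nat.lt_floor_add_one _
  have hm1 : (1 : ℝ) ≤ m := by exact_mod_cast hn
  set r : Fin n → ℝ := fun j => ((Finset.univ.filter fun i => ρ / √(n : ℝ) ≤ ‖V i j‖).card : ℝ)
    with hr
  have hrk : ∀ j, r j ≤ k := by
    intro j
    have := Finset.card_filter_le (Finset.univ : Finset (Fin k)) fun i => ρ / √(n : ℝ) ≤ ‖V i j‖
    rw [Finset.card_univ, Fintype.card_fin] at this
    exact Nat.cast_le.2 this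
  have hrsum : k * (η * n / 2) ≤ ∑ j, r j := by
    have e : ∑ j, r j =
        ∑ i, ((Finset.univ.filter fun j => ρ / √(n : ℝ) ≤ ‖V i j‖).card : ℝ) := by
      simp only [hr, Finset.card_filter]
      push_cast
      exact Finset.sum_comm
    rw [e]
    calc k * (η * n / 2) = ∑ _i : Fin k, η * n / 2 := by simp
      _ ≤ _ := Finset.sum_le_sum fun i _ => ?_
    have h : (m : ℝ) ≤ ((Finset.univ.filter fun j => ρ / √(n : ℝ) ≤ ‖V i j‖).card : ℝ) := by
      exact_mod_cast le_card_of_le_orderStat hn hmn (hrow i)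
    linarith
  have hcol : ∀ j, r j * (ρ ^ 2 / n) ≤ ‖colVec V j‖ ^ 2 := by
    intro j
    rw [norm_colVec_sq, ← nsmul_eq_mul]
    refine (Finset.card_nsmul_le_sum _ (fun i => ‖V i j‖ ^ 2) _ fun i hi => ?_).trans
      (Finset.sum_le_sum_of_subset_of_nonneg (Finset.filter_subset _ _)
        fun i _ _ => by positivity)
    have := (Finset.mem_filter.1 hi).2
    calc ρ ^ 2 / n = (ρ / √(n : ℝ)) ^ 2 := by rw [div_pow, Real.sq_sqrt hn0.le]
      _ ≤ _ := by gcongr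
  set L : Finset (Fin n) := Finset.univ.filter fun j => η * k / 4 ≤ r j with hL
  set U : Finset (Fin n) := Finset.univ.filter fun j => 8 * k / (η * n) < ‖colVec V j‖ ^ 2 with hU
  -- The `r j` sum to at least `k η n / 2` and none exceeds `k`, while columns outside `L`
  -- contribute at most `η k n / 4` altogether.
  have hLcard : η * n / 4 ≤ L.card := by
    have h1 : ∑ j, r j ≤ L.card * k + n * (η * k / 4) := by
      calc ∑ j, r j ≤ ∑ j : Fin n, ((if η * k / 4 ≤ r j then (k : ℝ) else 0) + η * k / 4) := by
            refine Finset.sum_le_sum fun j _ => ?_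
            split_ifs with h
            · have := hrk j
              have : 0 ≤ η * k / 4 := by positivity
              linarith
            · linarith
        _ = _ := by
            rw [Finset.sum_add_distrib, ← Finset.sum_filter]
            simp [hL]
    have h2 : (η * n / 4) * k ≤ L.card * k := by linarith
    exact le_of_mul_le_mul_right h2 hk0
  have hUcard : (U.card : ℝ) ≤ η * n / 8 := by
    have h1 : (U.card : ℝ) * (8 * k / (η * n)) ≤ k := by
      calc (U.card : ℝ) * (8 * k / (η * n)) ≤ ∑ j ∈ U, ‖colVec V j‖ ^ 2 := by
            rw [← nsmul_eq_mul]
            exact Finset.card_nsmul_le_sum _ _ _ fun j hj => (Finset.mem_filter.1 hj).2.le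
        _ ≤ ∑ j, ‖colVec V j‖ ^ 2 := Finset.sum_le_sum_of_subset_of_nonneg
            (Finset.subset_univ _) fun j _ _ => by positivity
        _ = k := sum_norm_colVec_sq hV
    have h2 : (U.card : ℝ) * (8 * k / (η * n)) = U.card / (η * n / 8) * k := by field_simp
    rw [h2] at h1
    have h3 : U.card / (η * n / 8) ≤ 1 := by
      refine le_of_mul_le_mul_right ?_ hk0
      linarith
    exact (div_le_one (by positivity)).1 h3
  refine ⟨L \ U, ?_, fun j hj => ?_⟩
  · have := Finset.le_card_sdiff U L
    have h : (L.card : ℝ) ≤ (L \ U).card + U.card := by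
      exact_mod_cast Nat.sub_le_iff_le_add.1 this
    linarith
  · obtain ⟨h1, h2⟩ := Finset.mem_sdiff.1 hj
    constructor
    · refine le_trans ?_ (hcol j)
      have := (Finset.mem_filter.1 h1).2
      calc ρ ^ 2 * η * k / (4 * n) = η * k / 4 * (ρ ^ 2 / n) := by field_simp
        _ ≤ _ := by gcongr
    · by_contra hcon
      exact h2 (Finset.mem_filter.2 ⟨Finset.mem_univ _, not_le.1 hcon⟩)

/-- The deterministic core: many column subsets of cardinality `l` are bounded and invertible. -/
theorem exists_many_good_column_sets (hV : Orthonormal ℂ (rowVec V)) {η ρ : ℝ} (hη : 0 < η)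
    (hη1 : η < 1) (hρ : 0 < ρ) (hn : 1 ≤ ⌊η * n⌋₊)
    (hrow : ∀ i : Fin k, ρ / √(n : ℝ) ≤ orderStat (V i) ⌊η * n⌋₊)
    {l : ℕ} (hl : (l : ℝ) ≤ 1 / 8192 * η ^ 3 * ρ ^ 2 * k) :
    ∃ F : Finset (Finset (Fin n)), (η * n / 16) ^ l ≤ l.factorial * F.card ∧
      ∀ S ∈ F, S.card = l ∧ ColumnsBounded V 8 η S ∧ ColumnsInvertible V (1 / 4) η ρ S := by
  rcases Nat.eq_zero_or_pos k with hk | hk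
  · have hl0 : l = 0 := by
      subst hk
      simpa using hl
    subst hl0
    refine ⟨{∅}, by simp, fun S hS => ?_⟩
    rw [Finset.mem_singleton.1 hS]
    refine ⟨rfl, fun j hj => absurd hj (Finset.notMem_empty j), fun z => ?_⟩
    have : z = 0 := by
      ext j
      exact absurd j.2 (Finset.notMem_empty _)
    simp [this]
  have hn0 : (0 : ℝ) < n := by
    rcases Nat.eq_zero_or_pos n with rfl | h
    · simp at hn
    · exact_mod_cast h
  have hk0 : (0 : ℝ) < k := by exact_mod_cast hk
  obtain ⟨G, hG, hcol⟩ := exists_balanced_columns hV hη hη1 hρ hk hn hrow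
  set a : ℝ := ρ ^ 2 * η * k / (4 * n) with ha
  have ha0 : 0 < a := by positivity
  have hv0 : ∀ j ∈ G, 0 < ‖colVec V j‖ := by
    intro j hj
    have := (hcol j hj).1
    by_contra hcon
    have : ‖colVec V j‖ = 0 := le_antisymm (not_lt.1 hcon) (norm_nonneg _)
    simp [this] at *
    linarith
  set x : Fin n → EuclideanSpace ℂ (Fin k) := fun j => ((‖colVec V j‖⁻¹ : ℝ) : ℂ) • colVec V j
    with hx
  have hx1 : ∀ j ∈ G, ‖x j‖ = 1 := by
    intro j hj
    rw [hx, norm_smul, Complex.norm_real, norm_inv, norm_norm, inv_mul_cancel₀ (hv0 j hj).ne']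
  have hB : ∀ y, ∑ j ∈ G, ‖⟪y, x j⟫_ℂ‖ ^ 2 ≤ a⁻¹ * ‖y‖ ^ 2 := by
    intro y
    calc ∑ j ∈ G, ‖⟪y, x j⟫_ℂ‖ ^ 2 ≤ ∑ j ∈ G, a⁻¹ * ‖⟪y, colVec V j⟫_ℂ‖ ^ 2 := by
          refine Finset.sum_le_sum fun j hj => ?_
          rw [hx, inner_smul_right, norm_mul, mul_pow, Complex.norm_real, norm_inv, norm_norm,
            inv_pow]
          gcongr
          exact (hcol j hj).1
      _ = a⁻¹ * ∑ j ∈ G, ‖⟪y, colVec V j⟫_ℂ‖ ^ 2 := by rw [Finset.mul_sum]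
      _ ≤ a⁻¹ * ∑ j, ‖⟪y, colVec V j⟫_ℂ‖ ^ 2 := by
          gcongr
          exact Finset.subset_univ _
      _ = _ := by rw [sum_norm_inner_colVec_sq hV]
  have hBl : a⁻¹ * l ≤ G.card / 256 := by
    rw [inv_mul_le_iff₀ ha0]
    -- `8192 = 4 * 8 * 256`: the `4` from `a`, the `8` from the size of `G`, the `256` from the
    -- selection. Only `η ^ 2` is needed here.
    calc (l : ℝ) ≤ 1 / 8192 * η ^ 3 * ρ ^ 2 * k := hl
      _ ≤ 1 / 8192 * η ^ 2 * ρ ^ 2 * k := by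
          have : η ^ 3 ≤ η ^ 2 := pow_le_pow_of_le_one hη.le hη1.le (by norm_num)
          gcongr
      _ = a * ((η * n / 8) / 256) := by rw [ha]; field_simp; norm_num
      _ ≤ _ := by gcongr
  obtain ⟨F, hF, hgood⟩ := exists_many_invertible_subsets G x hx1 (by positivity) hB hBl
  refine ⟨F, le_trans ?_ hF, fun S hS => ?_⟩
  · exact pow_le_pow_left₀ (by positivity) (by linarith) l
  obtain ⟨hSG, hSc, hinv⟩ := hgood S hS
  refine ⟨hSc, fun j hj => ?_, fun z => ?_⟩
  · exact Real.le_sqrt_of_sq_le (hcol j (hSG hj)).2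
  · classical
    -- The coefficients absorb the column norms, which undoes the normalization; the lower bound `a`
    -- on the squared norms then enters in `h3`.
    set z' : Fin n → ℂ := fun j => if h : j ∈ S then z ⟨j, h⟩ * (‖colVec V j‖ : ℂ) else 0 with hz'
    have h1 := hinv z'
    have h2 : ∑ j ∈ S, z' j • x j = ∑ j : S, z j • colVec V j := by
      rw [← Finset.sum_coe_sort]
      refine Finset.sum_congr rfl fun j _ => ?_
      have := (hv0 j (hSG j.2)).ne'
      have hc : ((‖colVec V j‖ : ℝ) : ℂ) ≠ 0 := by exact_mod_cast this
      simp only [hz', hx, dif_pos j.2, smul_smul]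
      push_cast
      rw [mul_assoc, mul_inv_cancel₀ hc, mul_one]
    have h3 : a * ‖z‖ ^ 2 ≤ ∑ j ∈ S, ‖z' j‖ ^ 2 := by
      rw [EuclideanSpace.norm_sq_eq, Finset.mul_sum, ← Finset.sum_coe_sort S]
      refine Finset.sum_le_sum fun j _ => ?_
      simp only [hz', dif_pos j.2, norm_mul, mul_pow, Complex.norm_real, norm_norm]
      rw [mul_comm]
      gcongr
      exact (hcol j (hSG j.2)).1
    rw [h2] at h1
    refine le_of_sq_le_sq ?_ (norm_nonneg _)
    calc (1 / 4 * ρ * √(η * (k / n)) * ‖z‖) ^ 2 = 1 / 4 * (a * ‖z‖ ^ 2) := by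
          rw [mul_pow, mul_pow, Real.sq_sqrt (by positivity), ha]
          field_simp
      _ ≤ 1 / 4 * ∑ j ∈ S, ‖z' j‖ ^ 2 := by gcongr
      _ ≤ _ := h1

end Columns

/-! ### Probability of hitting a prescribed set. -/

section RandomSubsets

open scoped ENNReal

variable {Ω : Type*} [MeasurableSpace Ω] {P : Measure Ω} {n : ℕ}

theorem card_mul_le_measure_of_levels {α : Type*} {X : Ω → α} (F : Finset α) {q : ℝ≥0∞}
    (hm : ∀ S ∈ F, MeasurableSet {ω | X ω = S}) (hq : ∀ S ∈ F, q ≤ P {ω | X ω = S})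
    {p : α → Prop} (hp : ∀ S ∈ F, p S) : F.card * q ≤ P {ω | p (X ω)} := by
  calc F.card * q = ∑ _S ∈ F, q := by rw [Finset.sum_const, nsmul_eq_mul]
    _ ≤ ∑ S ∈ F, P {ω | X ω = S} := Finset.sum_le_sum hq
    _ = P (⋃ S ∈ F, {ω | X ω = S}) := by
        refine (measure_biUnion_finset (fun S _ S' _ hne => ?_) hm).symm
        exact Set.disjoint_left.2 fun ω h h' => hne (h.symm.trans h')
    _ ≤ _ := by
        refine measure_mono fun ω hω => ?_
        simp only [Set.mem_iUnion] at hω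
        obtain ⟨S, hS, h⟩ := hω
        have h' : X ω = S := h
        show p (X ω)
        rw [h']
        exact hp S hS

theorem measurableSet_selectedSet_eq {β : Fin n → Ω → ℝ} (hβ : ∀ j, Measurable (β j))
    (S : Finset (Fin n)) : MeasurableSet {ω | selectedSet β ω = S} := by
  have h : {ω | selectedSet β ω = S} = ⋂ j, {ω | β j ω = 1 ↔ j ∈ S} := by
    ext ω
    simp [selectedSet, Finset.ext_iff]
  rw [h]
  refine MeasurableSet.iInter fun j => ?_
  by_cases hj : j ∈ S
  · simp only [hj, iff_true]
    exact hβ j (measurableSet_singleton 1)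
  · simp only [hj, iff_false]
    exact (hβ j (measurableSet_singleton 1)).compl

theorem le_measure_selectedSet_eq {β : Fin n → Ω → ℝ} {p : ℝ} (hp0 : 0 ≤ p) (hp1 : p ≤ 1)
    (hβ : ∀ j, IsBernoulli P (β j) p) (hind : iIndepFun β P) (S : Finset (Fin n)) :
    ENNReal.ofReal (p ^ S.card * (1 - p) ^ (n - S.card)) ≤ P {ω | selectedSet β ω = S} := by
  classical
  have h := hind.measure_inter_preimage_eq_mul Finset.univ
    (sets := fun j => if j ∈ S then {1} else {0})
    (fun j _ => by split_ifs <;> exact measurableSet_singleton _)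
  have hprod : ∏ j, P (β j ⁻¹' (if j ∈ S then {1} else {0})) =
      ENNReal.ofReal (p ^ S.card * (1 - p) ^ (n - S.card)) := by
    have e : ∀ j, P (β j ⁻¹' (if j ∈ S then {1} else {0})) =
        if j ∈ S then ENNReal.ofReal p else ENNReal.ofReal (1 - p) := by
      intro j
      split_ifs
      · exact (hβ j).2.1
      · exact (hβ j).2.2
    simp_rw [e]
    rw [Finset.prod_ite, Finset.prod_const, Finset.prod_const,
      ENNReal.ofReal_mul (by positivity), ENNReal.ofReal_pow hp0,
      ENNReal.ofReal_pow (by linarith)]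
    congr 2
    · simp
    · rw [Finset.filter_not, Finset.card_sdiff_of_subset (Finset.filter_subset _ _)]
      simp
  rw [hprod] at h
  rw [← h]
  refine measure_mono fun ω hω => ?_
  simp only [Set.mem_iInter, Finset.mem_univ, true_imp_iff, Set.mem_preimage] at hω
  ext j
  have := hω j
  by_cases hj : j ∈ S
  · simp only [hj, if_true, Set.mem_singleton_iff] at this
    simp [selectedSet, hj, this]
  · simp only [hj, if_false, Set.mem_singleton_iff] at this
    simp [selectedSet, hj, this]

/-- For `l < n` and `d = n - l`, the base is `(1 + l / d)⁻¹`, and `(1 + l / d) ^ d ≤ e ^ l ≤ 3 ^ l`.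
-/
theorem inv_three_pow_le {l n : ℕ} (hln : l ≤ n) :
    (1 / 3 : ℝ) ^ l ≤ (1 - (l : ℝ) / n) ^ (n - l) := by
  rcases hln.eq_or_lt with rfl | h
  · simpa using pow_le_one₀ (n := l) (by norm_num : (0 : ℝ) ≤ 1 / 3) (by norm_num)
  have hn0 : (0 : ℝ) < n := by exact_mod_cast (by omega : 0 < n)
  have hd : (0 : ℝ) < ((n - l : ℕ) : ℝ) := by exact_mod_cast Nat.sub_pos_of_lt h
  have hcast : ((n - l : ℕ) : ℝ) = n - l := by push_cast [hln]; ring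
  set d : ℕ := n - l
  have e1 : 1 - (l : ℝ) / n = ((l : ℝ) / d + 1)⁻¹ := by
    rw [hcast] at hd ⊢
    field_simp
    ring
  have h1 : ((l : ℝ) / d + 1) ^ d ≤ 3 ^ l := by
    calc ((l : ℝ) / d + 1) ^ d ≤ Real.exp ((l : ℝ) / d) ^ d := by
          gcongr
          exact Real.add_one_le_exp _
      _ = Real.exp 1 ^ l := by
          rw [← Real.exp_nat_mul, ← Real.exp_nat_mul]
          congr 1
          field_simp
      _ ≤ 3 ^ l := by
          gcongr
          exact (Real.exp_one_lt_d9.trans (by norm_num)).le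
  rw [e1, inv_pow, one_div, inv_pow]
  gcongr

end RandomSubsets

/-! ### Constants and conclusion for both random models. -/

theorem lemma7p1 :
    ∃ ctilde chat C c : ℝ, 0 < ctilde ∧ 0 < chat ∧ 0 < C ∧ 0 < c ∧
      ∀ (η ρ : ℝ), 0 < η → η < 1 → 0 < ρ →
      ∀ (k n : ℕ), k < n → 1 ≤ ⌊η * n⌋₊ →
      ∀ V : Matrix (Fin k) (Fin n) ℂ,
        Orthonormal ℂ (rowVec V) →
        (∀ i : Fin k, ρ / √(n : ℝ) ≤ orderStat (V i) ⌊η * n⌋₊) →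
      ∀ l : ℕ, l = ⌊ctilde * η ^ 3 * ρ ^ 2 * k⌋₊ →
        l ≤ n ∧
        (∀ (Ω : Type*) [MeasurableSpace Ω] (P : Measure Ω) [IsProbabilityMeasure P]
          (β : Fin n → Ω → ℝ),
          (∀ j, IsBernoulli P (β j) ((l : ℝ) / n)) → iIndepFun β P →
          ENNReal.ofReal ((chat * η) ^ l) ≤
            P {ω | (selectedSet β ω).card = l ∧
              ColumnsBounded V C η (selectedSet β ω) ∧
              ColumnsInvertible V c η ρ (selectedSet β ω)}) ∧
        (∀ (Ω : Type*) [MeasurableSpace Ω] (P : Measure Ω) [IsProbabilityMeasure P]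
          (I : Ω → Finset (Fin n)),
          IsUniformSubset P I l →
          ENNReal.ofReal ((chat * η) ^ l) ≤
            P {ω | ColumnsBounded V C η (I ω) ∧ ColumnsInvertible V c η ρ (I ω)}) := by
  -- `48 = 16 * 3`: half of `η n / 8` choices per step gives `16`, and `inv_three_pow_le` gives `3`.
  refine ⟨1 / 8192, 1 / 48, 8, 1 / 4, by norm_num, by norm_num, by norm_num, by norm_num, ?_⟩
  intro η ρ hη hη1 hρ k n hkn hn V hV hrow l hl
  have hl' : (l : ℝ) ≤ 1 / 8192 * η ^ 3 * ρ ^ 2 * k := by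
    rw [hl]
    exact Nat.floor_le (by positivity)
  have hn0 : (0 : ℝ) < n := by exact_mod_cast (by omega : 0 < n)
  have hlk : (l : ℝ) ≤ k := by
    rcases Nat.eq_zero_or_pos k with rfl | hk
    · simpa using hl'
    have h2 := eta_mul_rho_sq_le_two hV hη hη1 hρ hn ⟨0, hk⟩ (hrow _)
    have h3 : η ^ 2 ≤ 1 := pow_le_one₀ hη.le hη1.le
    calc (l : ℝ) ≤ 1 / 8192 * (η ^ 2 * (η * ρ ^ 2)) * k := by linarith
      _ ≤ 1 / 8192 * (1 * 2) * k := by gcongr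
      _ ≤ k := by nlinarith [(Nat.cast_nonneg k : (0 : ℝ) ≤ k)]
  have hln : l ≤ n := by
    have : l ≤ k := by exact_mod_cast hlk
    omega
  obtain ⟨F, hF, hgood⟩ := exists_many_good_column_sets hV hη hη1 hρ hn hrow hl'
  have hfac : (0 : ℝ) < l.factorial := by exact_mod_cast l.factorial_pos
  have hFc : (η * n / 16) ^ l / l.factorial ≤ F.card := by
    rw [div_le_iff₀ hfac]; linarith
  refine ⟨hln, ?_, ?_⟩
  · intro Ω _ P _ β hβ hind
    have hp1 : (l : ℝ) / n ≤ 1 := by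
      rw [div_le_one hn0]; exact_mod_cast hln
    have hp0 : (0 : ℝ) ≤ (l : ℝ) / n := by positivity
    have hlow := card_mul_le_measure_of_levels (P := P) F
      (q := ENNReal.ofReal (((l : ℝ) / n) ^ l * (1 - (l : ℝ) / n) ^ (n - l)))
      (fun S _ => measurableSet_selectedSet_eq (fun j => (hβ j).1) S)
      (fun S hS => by
        have := le_measure_selectedSet_eq hp0 hp1 hβ hind S
        rwa [(hgood S hS).1] at this)
      (p := fun S => S.card = l ∧ ColumnsBounded V 8 η S ∧ ColumnsInvertible V (1 / 4) η ρ S)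
      hgood
    refine le_trans ?_ hlow
    rw [← ENNReal.ofReal_natCast, ← ENNReal.ofReal_mul (Nat.cast_nonneg _)]
    refine ENNReal.ofReal_le_ofReal ?_
    -- The factor `l ^ l` from the Bernoulli weight cancels the `l!` lost in passing from tuples to
    -- sets.
    have hll : (l.factorial : ℝ) ≤ (l : ℝ) ^ l := by exact_mod_cast Nat.factorial_le_pow l
    calc (1 / 48 * η) ^ l = (η / 16) ^ l * 1 * (1 / 3) ^ l := by
          rw [mul_one, ← mul_pow]; congr 1; ring
      _ ≤ (η / 16) ^ l * ((l : ℝ) ^ l / l.factorial) * (1 - (l : ℝ) / n) ^ (n - l) := by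
          gcongr
          · exact (one_le_div hfac).2 hll
          · exact inv_three_pow_le hln
      _ = (η * n / 16) ^ l / l.factorial * (((l : ℝ) / n) ^ l * (1 - (l : ℝ) / n) ^ (n - l)) := by
          rw [div_pow (l : ℝ), show η * n / 16 = η / 16 * n by ring, mul_pow]
          field_simp
      _ ≤ _ := by
          have : 0 ≤ 1 - (l : ℝ) / n := by linarith
          gcongr
  · intro Ω _ P _ I hI
    have hch : (0 : ℝ) < n.choose l := by exact_mod_cast Nat.choose_pos hln
    have hlow := card_mul_le_measure_of_levels (P := P) F (q := ((n.choose l : ENNReal))⁻¹)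
      (fun S _ => hI.1 S) (fun S hS => by rw [hI.2 S, if_pos (hgood S hS).1])
      (p := fun S => ColumnsBounded V 8 η S ∧ ColumnsInvertible V (1 / 4) η ρ S)
      (fun S hS => (hgood S hS).2)
    refine le_trans ?_ hlow
    rw [← ENNReal.ofReal_natCast, ← ENNReal.ofReal_natCast, ← ENNReal.ofReal_inv_of_pos hch,
      ← ENNReal.ofReal_mul (Nat.cast_nonneg _)]
    refine ENNReal.ofReal_le_ofReal ?_
    rw [← div_eq_mul_inv, le_div_iff₀ hch]
    calc (1 / 48 * η) ^ l * n.choose l ≤ (η / 16) ^ l * ((n : ℝ) ^ l / l.factorial) := by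
          gcongr
          · linarith
          · exact Nat.choose_le_pow_div l n
      _ = (η * n / 16) ^ l / l.factorial := by
          rw [show η * n / 16 = η / 16 * n by ring, mul_pow]; ring
      _ ≤ _ := hFc
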